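/- For a polynomial $P\in\mathbb{Z}[X]$ let $H(P)$ be the maximum of the absolute values of its coefficients, and for an algebraic number $\alpha\in\mathbb{C}$ let $H(\alpha)$ be the height of its minimal polynomial over $\mathbb{Z}$. For a real number $\xi$ and an integer $n\ge 1$, let $\widehat{w}_n(\xi)$ be the supremum of the real numbers $w$ such that, for all sufficiently large real $H$, there is $P\in\mathbb{Z}[X]$ of degree at most $n$ with $$0<|P(\xi)|\le H^{-w},\qquad H(P)\le H,$$ and let $\widehat{w}_n^{*}(\xi)$ be the supremum of the real numbers $w$ such that, for all sufficiently large real $H$, there is an algebraic number $\alpha\in\mathbb{C}$ of degree at most $n$ with $$0<|\xi-\alpha|\le H(\alpha)^{-1}H^{-w},\qquad H(\alpha)\le H.$$ A transcendental real number $\xi$ is called extremal if $\widehat{w}_2(\xi)=\frac{3+\sqrt5}{2}$. Every extremal number $\xi$ satisfies $$\widehat{w}_3^{*}(\xi)\le 3\,\frac{2+\sqrt5}{1+\sqrt5}=3.9270\ldots\qquad\text{and}\qquad \widehat{w}_3(\xi)\le 4.$$ -/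

import Mathlib

open Polynomial Filter

/-- The minimal polynomial over `ℤ` of an algebraic number `α`, determined up to sign: the primitive
integer polynomial proportional to the monic minimal polynomial of `α` over `ℚ`.
(Mathlib's `minpoly ℤ α` is only meaningful for algebraic integers.) -/
noncomputable def intMinpoly (α : ℂ) : ℤ[X] :=
  (IsLocalization.integerNormalization (nonZeroDivisors ℤ) (minpoly ℚ α)).primPart

/-- The height `H(α)` of an algebraic number: the maximal absolute value of the coefficients
(`Polynomial.supNorm`) of its minimal polynomial over `ℤ`. -/
noncomputable def algHeight (α : ℂ) : ℝ := (intMinpoly α).supNorm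

theorem intMinpoly_map {α : ℂ} (hα : IsAlgebraic ℚ α) :
    Associated ((intMinpoly α).map (Int.castRingHom ℚ)) (minpoly ℚ α) := by
  have h0 : minpoly ℚ α ≠ 0 := minpoly.ne_zero hα.isIntegral
  obtain ⟨b, hb, h⟩ := IsLocalization.integerNormalization_spec (nonZeroDivisors ℤ) (minpoly ℚ α)
  have hb0 : b ≠ 0 := nonZeroDivisors.ne_zero hb
  have hn0 : IsLocalization.integerNormalization (nonZeroDivisors ℤ) (minpoly ℚ α) ≠ 0 := by
    rwa [Ne, IsFractionRing.integerNormalization_eq_zero_iff]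
  have hc0 := mt content_eq_zero_iff.1 hn0
  have e := (IsLocalization.integerNormalization
    (nonZeroDivisors ℤ) (minpoly ℚ α)).eq_C_content_mul_primPart
  rw [e, Polynomial.map_mul, map_C] at h
  change C _ * (intMinpoly α).map (algebraMap ℤ ℚ) = _ at h
  have u1 : IsUnit (C (algebraMap ℤ ℚ (IsLocalization.integerNormalization
      (nonZeroDivisors ℤ) (minpoly ℚ α)).content)) := by
    rw [isUnit_C, isUnit_iff_ne_zero]
    simpa using hc0
  have u2 : IsUnit (C (b : ℚ)) := by
    rw [isUnit_C, isUnit_iff_ne_zero]; exact_mod_cast hb0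
  have h2 : b • minpoly ℚ α = C (b : ℚ) * minpoly ℚ α := by
    rw [← smul_eq_C_mul, Int.cast_smul_eq_zsmul]
  rw [h2] at h
  have a1 := associated_unit_mul_left ((intMinpoly α).map (algebraMap ℤ ℚ)) _ u1
  rw [h] at a1
  exact a1.symm.trans (associated_unit_mul_left _ _ u2)

theorem irreducible_intMinpoly {α : ℂ} (hα : IsAlgebraic ℚ α) : Irreducible (intMinpoly α) := by
  refine (IsPrimitive.Int.irreducible_iff_irreducible_map_cast (isPrimitive_primPart _)).2 ?_
  exact (intMinpoly_map hα).symm.irreducible (minpoly.irreducible hα.isIntegral)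

theorem aeval_intMinpoly {α : ℂ} (hα : IsAlgebraic ℚ α) : aeval α (intMinpoly α) = 0 := by
  obtain ⟨q, hq⟩ := (intMinpoly_map hα).symm.dvd
  have : aeval α ((intMinpoly α).map (algebraMap ℤ ℚ)) = 0 := by
    change aeval α ((intMinpoly α).map (Int.castRingHom ℚ)) = 0
    rw [hq]; simp
  rwa [aeval_map_algebraMap] at this

/-- Any irreducible integer polynomial vanishing at `α` is the minimal polynomial up to sign. -/
theorem intMinpoly_associated {α : ℂ} {P : ℤ[X]} (hP : Irreducible P) (h : aeval α P = 0) :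
    Associated (intMinpoly α) P := by
  have hα : IsAlgebraic ℚ α :=
    IsAlgebraic.extendScalars (algebraMap ℤ ℚ).injective_int ⟨P, hP.ne_zero, h⟩
  refine (irreducible_intMinpoly hα).associated_of_dvd hP ?_
  refine (IsPrimitive.Int.dvd_iff_map_cast_dvd_map_cast (intMinpoly α) P
    (isPrimitive_primPart _)).2 ?_
  refine (intMinpoly_map hα).dvd.trans (minpoly.dvd ℚ α ?_)
  change aeval α (P.map (algebraMap ℤ ℚ)) = 0
  rwa [aeval_map_algebraMap]

/-- The uniform exponent `ŵ_n(ξ)`: the supremum (in `[-∞, ∞]`) of the real numbers `w` such that,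
for all large real `H`, some integer polynomial `P` of degree at most `n` satisfies
`0 < |P(ξ)| ≤ H ^ (-w)` and `H(P) ≤ H`. -/
noncomputable def wHat (n : ℕ) (ξ : ℝ) : EReal :=
  sSup {x : EReal | ∃ w : ℝ, x = (w : EReal) ∧
    ∀ᶠ H : ℝ in atTop, ∃ P : ℤ[X], P.natDegree ≤ n ∧ P.supNorm ≤ H ∧
      0 < |aeval ξ P| ∧ |aeval ξ P| ≤ H ^ (-w)}

/-- The uniform exponent `ŵ_n^*(ξ)`: the supremum (in `[-∞, ∞]`) of the real numbers `w` such that,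
for all large real `H`, some (real or complex) algebraic number `α` of degree at most `n` satisfies
`0 < |ξ - α| ≤ H(α)⁻¹ * H ^ (-w)` and `H(α) ≤ H`. -/
noncomputable def wHatStar (n : ℕ) (ξ : ℝ) : EReal :=
  sSup {x : EReal | ∃ w : ℝ, x = (w : EReal) ∧
    ∀ᶠ H : ℝ in atTop, ∃ α : ℂ, IsAlgebraic ℚ α ∧ (minpoly ℚ α).natDegree ≤ n ∧
      algHeight α ≤ H ∧ 0 < ‖(ξ : ℂ) - α‖ ∧ ‖(ξ : ℂ) - α‖ ≤ (algHeight α)⁻¹ * H ^ (-w)}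

/-- An extremal number: a transcendental real number `ξ` with `ŵ_2(ξ) = (3 + √5) / 2`. -/
def IsExtremalNumber (ξ : ℝ) : Prop :=
  Transcendental ℚ ξ ∧ wHat 2 ξ = (((3 + √5) / 2 : ℝ) : EReal)

/-! The proof plays one very good quadratic approximation against the uniform cubic ones. Jarník's
transference (`exists_abs_quadForm_mul_norm_rpow_lt`) turns a uniform exponent `w` in degree two
into ordinary approximations of every exponent below `w * (w - 1)`. For extremal `ξ` the value of `w
* (w - 1)` is `2 + √5 > 4.23`, so there is room for exponent `4.1`. Multiplicativity of the Mahler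
measure makes these approximations irreducible (`exists_irreducible_of_forall_exists_small`), giving
`P` of arbitrarily large height with `|P(ξ)| ≤ H(P) ^ (-4.1)`.

If `Q` has degree at most three and `P ∤ Q`, the nonzero integer resultant forces `1 ≪ H(P)² H(Q)²
|P(ξ)| + H(P)³ H(Q) |Q(ξ)|` (`exists_one_le_of_not_dvd`). For `ŵ₃`, take `Q` of height slightly
below `H(P)`: then `P ∤ Q` by comparison of heights, and an exponent above `4` makes both terms
small. For `ŵ₃*`, the height bound is tuned to `|P(ξ)|` and `Q` is the minimal polynomial of `α`; if
`P ∣ Q`, then `α` is a root of `P` too close to `ξ`. This yields `3.92`, below the required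
`3.9270...`. -/

/-! ### Integer vectors, the linear form `quadForm`, and Jarník's transference. -/

/-- The value at `ξ` of the quadratic polynomial with coefficient vector `v`. -/
def quadForm (ξ : ℝ) (v : Fin 3 → ℤ) : ℝ := v 0 + v 1 * ξ + v 2 * ξ ^ 2

theorem abs_coord_le_norm (v : Fin 3 → ℤ) (i : Fin 3) : |(v i : ℝ)| ≤ ‖v‖ := by
  have := norm_le_pi_norm v i
  rwa [Int.norm_eq_abs] at this

theorem abs_minor_le (v u : Fin 3 → ℤ) (i j : Fin 3) :
    |(v i : ℝ) * u j - v j * u i| ≤ 2 * ‖v‖ * ‖u‖ := by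
  have h1 : |(v i : ℝ) * u j| ≤ ‖v‖ * ‖u‖ := by
    rw [abs_mul]; gcongr <;> exact abs_coord_le_norm _ _
  have h2 : |(v j : ℝ) * u i| ≤ ‖v‖ * ‖u‖ := by
    rw [abs_mul]; gcongr <;> exact abs_coord_le_norm _ _
  linarith [abs_sub ((v i : ℝ) * u j) (v j * u i)]

/-- Adding `ξ` and `ξ ^ 2` times the other columns to the first column of the determinant turns it
into the column of values; expand along it. -/
theorem abs_tripleProduct_le (ξ : ℝ) (p q r : Fin 3 → ℤ) :
    |((dotProduct (crossProduct p q) r : ℤ) : ℝ)| ≤ 2 * (|quadForm ξ p| * (‖q‖ * ‖r‖) +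
      |quadForm ξ q| * (‖p‖ * ‖r‖) + |quadForm ξ r| * (‖p‖ * ‖q‖)) := by
  have e : ((dotProduct (crossProduct p q) r : ℤ) : ℝ) =
      quadForm ξ p * (q 1 * r 2 - q 2 * r 1) - quadForm ξ q * (p 1 * r 2 - p 2 * r 1) +
      quadForm ξ r * (p 1 * q 2 - p 2 * q 1) := by
    simp only [dotProduct, Fin.sum_univ_three, cross_apply, quadForm]
    simp
    ring
  have h1 := mul_le_mul_of_nonneg_left (abs_minor_le q r 1 2) (abs_nonneg (quadForm ξ p))
  have h2 := mul_le_mul_of_nonneg_left (abs_minor_le p r 1 2) (abs_nonneg (quadForm ξ q))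
  have h3 := mul_le_mul_of_nonneg_left (abs_minor_le p q 1 2) (abs_nonneg (quadForm ξ r))
  rw [← abs_mul] at h1 h2 h3
  rw [e]
  refine (abs_add_le _ _).trans ((add_le_add_left (abs_sub _ _) _).trans ?_)
  nlinarith

/-- `d` generates the ideal of the entries, and `u` is a Bézout certificate that `v'` is primitive.
-/
theorem exists_primitive_vector (v : Fin 3 → ℤ) (hv : v ≠ 0) :
    ∃ (d : ℤ) (v' u : Fin 3 → ℤ), d ≠ 0 ∧ v = d • v' ∧ dotProduct u v' = 1 := by
  obtain ⟨d, hd⟩ := (IsPrincipalIdealRing.principal (Ideal.span (Set.range v))).principal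
  have hm : ∀ i, ∃ c, v i = d * c := fun i => by
    have : v i ∈ Ideal.span (Set.range v) := Ideal.subset_span ⟨i, rfl⟩
    rw [hd] at this
    obtain ⟨a, ha⟩ := Submodule.mem_span_singleton.1 this
    exact ⟨a, by rw [← ha]; simp [mul_comm]⟩
  choose v' hv' using hm
  have hd0 : d ≠ 0 := by
    rintro rfl
    exact hv (funext fun i => by simp [hv' i])
  have hdm : d ∈ Ideal.span (Set.range v) := by
    rw [hd]; exact Submodule.mem_span_singleton_self d
  obtain ⟨u, hu⟩ := Ideal.mem_span_range_iff_exists_fun.1 hdm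
  refine ⟨d, v', u, hd0, funext fun i => by simp [hv' i], ?_⟩
  apply mul_left_cancel₀ hd0
  rw [mul_one]
  conv_rhs => rw [← hu]
  rw [dotProduct, Finset.mul_sum]
  exact Finset.sum_congr rfl fun i _ => by rw [hv' i]; ring

theorem quadForm_smul (ξ : ℝ) (d : ℤ) (v : Fin 3 → ℤ) :
    quadForm ξ (d • v) = d * quadForm ξ v := by
  simp [quadForm]; ring

/-- Vectors of strictly smaller nonzero value are independent of a given primitive vector. -/
theorem cross_ne_zero_of_abs_quadForm_lt {ξ : ℝ} {p q u : Fin 3 → ℤ} (hu : dotProduct u p = 1)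
    (hq : 0 < |quadForm ξ q|) (hlt : |quadForm ξ q| < |quadForm ξ p|) : crossProduct p q ≠ 0 := by
  intro h
  have e0 := congrFun h 0
  have e1 := congrFun h 1
  have e2 := congrFun h 2
  simp only [cross_apply, Matrix.cons_val_zero, Matrix.cons_val_one, Matrix.cons_val,
    Pi.zero_apply] at e0 e1 e2
  simp only [dotProduct, Fin.sum_univ_three] at hu
  -- If the cross product vanishes, primitivity of `p` makes `q` an integer multiple of `p`, whose
  -- value is zero or at least as large as that of `p`.
  have key : q = (u 0 * q 0 + u 1 * q 1 + u 2 * q 2) • p := by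
    funext i
    fin_cases i <;> simp only [Pi.smul_apply, smul_eq_mul, Fin.zero_eta, Fin.mk_one,
      Fin.reduceFinMk]
    · linear_combination (-q 0) * hu + u 2 * e1 - u 1 * e2
    · linear_combination (-q 1) * hu + u 0 * e2 - u 2 * e0
    · linear_combination (-q 2) * hu + u 1 * e0 - u 0 * e1
  set t := u 0 * q 0 + u 1 * q 1 + u 2 * q 2
  rw [key, quadForm_smul, abs_mul] at hq hlt
  have ht : t ≠ 0 := by rintro h0; simp [h0] at hq
  have : (1 : ℝ) ≤ |(t : ℝ)| := by exact_mod_cast Int.one_le_abs ht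
  nlinarith [abs_nonneg (quadForm ξ p)]

theorem dot_eq_zero_of_cross_eq_zero {m n r : Fin 3 → ℤ} (hm : m ≠ 0) (h : crossProduct m n = 0)
    (hr : dotProduct m r = 0) : dotProduct n r = 0 := by
  have e0 := congrFun h 0
  have e1 := congrFun h 1
  have e2 := congrFun h 2
  simp only [cross_apply, Matrix.cons_val_zero, Matrix.cons_val_one, Matrix.cons_val,
    Pi.zero_apply] at e0 e1 e2
  simp only [dotProduct, Fin.sum_univ_three] at hr ⊢
  obtain ⟨j, hj⟩ := Function.ne_iff.1 hm
  apply mul_left_cancel₀ hj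
  fin_cases j <;> simp only [Fin.zero_eta, Fin.mk_one, Fin.reduceFinMk]
  · linear_combination n 0 * hr + r 1 * e2 - r 2 * e1
  · linear_combination n 1 * hr + r 2 * e0 - r 0 * e2
  · linear_combination n 2 * hr + r 0 * e1 - r 1 * e0

/-- The direction of a nonzero integer vector stays away from that of `(1, ξ, ξ ^ 2)`. -/
theorem exists_pos_le_of_cross_eq_zero {ξ : ℝ} (hξ : Irrational ξ) {n : Fin 3 → ℤ} (hn : n ≠ 0) :
    ∃ κ : ℝ, 0 < κ ∧ ∀ m : Fin 3 → ℤ, m ≠ 0 → crossProduct m n = 0 →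
      κ ≤ |(m 1 : ℝ) - ξ * m 0| ∨ κ ≤ |(m 2 : ℝ) - ξ ^ 2 * m 0| := by
  have hpar : ∀ m : Fin 3 → ℤ, crossProduct m n = 0 →
      m 1 * n 2 - m 2 * n 1 = 0 ∧ m 2 * n 0 - m 0 * n 2 = 0 ∧ m 0 * n 1 - m 1 * n 0 = 0 := by
    intro m h
    have e0 := congrFun h 0
    have e1 := congrFun h 1
    have e2 := congrFun h 2
    simp only [cross_apply, Matrix.cons_val_zero, Matrix.cons_val_one, Matrix.cons_val,
      Pi.zero_apply] at e0 e1 e2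
    exact ⟨e0, e1, e2⟩
  by_cases h0 : n 0 = 0
  -- When `n 0 = 0`, a parallel `m` has `m 0 = 0`, so both distances are absolute values of
  -- integers, not both zero.
  · refine ⟨1, one_pos, fun m hm h => ?_⟩
    obtain ⟨e0, e1, e2⟩ := hpar m h
    have hm0 : m 0 = 0 := by
      by_contra hne
      apply hn
      funext i
      fin_cases i
      · exact h0
      · simpa [h0, hne] using e2
      · simpa [h0, hne] using e1
    by_cases hm1 : m 1 = 0
    · right
      have hm2 : m 2 ≠ 0 := by
        intro hm2
        apply hm
        funext i
        fin_cases i <;> assumption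
      simp only [hm0, Int.cast_zero, mul_zero, sub_zero]
      exact_mod_cast Int.one_le_abs hm2
    · left
      simp only [hm0, Int.cast_zero, mul_zero, sub_zero]
      exact_mod_cast Int.one_le_abs hm1
  · have hpos : 0 < |(n 1 : ℝ) - ξ * n 0| := by
      rw [abs_pos, sub_ne_zero]
      intro he
      refine (hξ.mul_intCast h0).ne_int (n 1) he.symm
    have hn0 : 0 < |(n 0 : ℝ)| := by simpa using h0
    refine ⟨|(n 1 : ℝ) - ξ * n 0| / |(n 0 : ℝ)|, by positivity, fun m hm h => Or.inl ?_⟩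
    obtain ⟨e0, e1, e2⟩ := hpar m h
    have hm0 : m 0 ≠ 0 := by
      intro hm0
      apply hm
      funext i
      fin_cases i
      · exact hm0
      · simpa [h0, hm0] using e2
      · simpa [h0, hm0] using e1
    have h1 : (1 : ℝ) ≤ |(m 0 : ℝ)| := by exact_mod_cast Int.one_le_abs hm0
    rw [div_le_iff₀ hn0, ← abs_mul]
    have e2' : (m 0 : ℝ) * n 1 - m 1 * n 0 = 0 := by exact_mod_cast e2
    have : ((m 1 : ℝ) - ξ * m 0) * n 0 = m 0 * (n 1 - ξ * n 0) := by
      linear_combination -e2'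
    rw [this, abs_mul]
    nlinarith

/-- Up to sign, both differences are coordinates of `L(p) q - L(q) p`, with `L` the form `quadForm
ξ`. So the cross product of two good solutions points almost along `(1, ξ, ξ ^ 2)`. -/
theorem abs_cross_sub_le (ξ : ℝ) (p q : Fin 3 → ℤ) :
    |((crossProduct p q 1 : ℤ) : ℝ) - ξ * (crossProduct p q 0 : ℤ)| ≤
        |quadForm ξ p| * ‖q‖ + |quadForm ξ q| * ‖p‖ ∧
      |((crossProduct p q 2 : ℤ) : ℝ) - ξ ^ 2 * (crossProduct p q 0 : ℤ)| ≤
        |quadForm ξ p| * ‖q‖ + |quadForm ξ q| * ‖p‖ := by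
  have key : ∀ i, |quadForm ξ p * q i - quadForm ξ q * p i| ≤
      |quadForm ξ p| * ‖q‖ + |quadForm ξ q| * ‖p‖ := fun i => by
    refine (abs_sub _ _).trans ?_
    rw [abs_mul, abs_mul]
    gcongr <;> exact abs_coord_le_norm _ _
  constructor
  · convert key 2 using 1
    rw [← abs_neg]
    congr 1
    simp [cross_apply, quadForm]
    ring
  · convert key 1 using 1
    congr 1
    simp [cross_apply, quadForm]
    ring

theorem exists_primitive_solution {ξ w : ℝ} (hw : 0 < w) {H : ℝ} (hH : 0 < H) {v : Fin 3 → ℤ}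
    (hv : ‖v‖ ≤ H) (h0 : 0 < |quadForm ξ v|) (h1 : |quadForm ξ v| ≤ H ^ (-w)) :
    ∃ (p u : Fin 3 → ℤ) (Y : ℝ), dotProduct u p = 1 ∧ ‖p‖ ≤ H ∧ H ≤ Y ∧
      |quadForm ξ p| = Y ^ (-w) := by
  have hv0 : v ≠ 0 := by rintro rfl; simp [quadForm] at h0
  obtain ⟨d, p, u, hd, rfl, hu⟩ := exists_primitive_vector v hv0
  have hd1 : (1 : ℝ) ≤ |(d : ℝ)| := by exact_mod_cast Int.one_le_abs hd
  rw [quadForm_smul, abs_mul] at h0 h1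
  have hp0 : 0 < |quadForm ξ p| := pos_of_mul_pos_right h0 (abs_nonneg _)
  have hp1 : |quadForm ξ p| ≤ H ^ (-w) := by nlinarith
  -- `Y` is the largest height bound for which `p` still meets the requirement on its value.
  refine ⟨p, u, |quadForm ξ p| ^ (-w⁻¹), hu, ?_, ?_, ?_⟩
  · rw [norm_smul, Int.norm_eq_abs] at hv
    nlinarith [norm_nonneg p]
  · calc H = (H ^ (-w)) ^ (-w⁻¹) := by
          rw [← Real.rpow_mul hH.le, neg_mul_neg, mul_inv_cancel₀ hw.ne', Real.rpow_one]
      _ ≤ _ := Real.rpow_le_rpow_of_nonpos hp0 hp1 (by simpa using hw.le)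
  · rw [← Real.rpow_mul hp0.le, neg_mul_neg, inv_mul_cancel₀ hw.ne', Real.rpow_one]

/-- Jarník's transference: uniform approximation to `0` by the values at `ξ` of integer polynomials
of degree at most two with exponent `w` entails approximation with any exponent below
`w * (w - 1)`. -/
theorem exists_abs_quadForm_mul_norm_rpow_lt {ξ : ℝ} (hξ : Irrational ξ) {w w' : ℝ} (hw : 1 < w)
    (hw' : 0 < w') (hlt : w' < w * (w - 1))
    (h : ∀ᶠ H : ℝ in atTop, ∃ v : Fin 3 → ℤ, ‖v‖ ≤ H ∧ 0 < |quadForm ξ v| ∧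
      |quadForm ξ v| ≤ H ^ (-w)) {ε : ℝ} (hε : 0 < ε) :
    ∃ v : Fin 3 → ℤ, 0 < |quadForm ξ v| ∧ |quadForm ξ v| * ‖v‖ ^ w' < ε := by
  by_contra! hcon
  have hw0 : 0 < w := by linarith
  -- the successor of a solution is at most polynomially larger
  set C : ℝ := (2 ^ w' / ε) ^ w⁻¹ with hC
  have hgrow : ∀ (q : Fin 3 → ℤ) (Y Z : ℝ), 0 < Y → 0 < Z → ‖q‖ ≤ 2 * Y →
      |quadForm ξ q| = Z ^ (-w) → Z ≤ C * Y ^ (w' / w) := by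
    intro q Y Z hY hZ hq hL
    have hpos : 0 < |quadForm ξ q| := by rw [hL]; positivity
    have h1 := hcon q hpos
    rw [hL, Real.rpow_neg hZ.le, inv_mul_eq_div, le_div_iff₀ (by positivity)] at h1
    have h2 : Z ^ w ≤ 2 ^ w' / ε * Y ^ w' := by
      rw [div_mul_eq_mul_div, le_div_iff₀ hε, ← Real.mul_rpow (by norm_num) hY.le, mul_comm]
      exact h1.trans (Real.rpow_le_rpow (norm_nonneg _) hq hw'.le)
    calc Z = (Z ^ w) ^ w⁻¹ := (Real.rpow_rpow_inv hZ.le hw0.ne').symm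
      _ ≤ (2 ^ w' / ε * Y ^ w') ^ w⁻¹ := by gcongr
      _ = C * Y ^ (w' / w) := by
        rw [Real.mul_rpow (by positivity) (by positivity), ← Real.rpow_mul hY.le, hC,
          div_eq_mul_inv w' w]
  -- The only use of `w' < w * (w - 1)`: it makes the determinants below tend to zero.
  have hθ : w' / w - (w - 1) < 0 := by
    rw [sub_neg, div_lt_iff₀ hw0]; linarith
  have hlim1 : ∀ᶠ Y : ℝ in atTop, 24 * C * Y ^ (w' / w - (w - 1)) < 1 := by
    have := (tendsto_rpow_neg_atTop (neg_pos.2 hθ)).const_mul (24 * C)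
    rw [mul_zero, neg_neg] at this
    exact this.eventually_lt_const one_pos
  obtain ⟨Y₀, hY₀⟩ := ((h.and hlim1).and (eventually_ge_atTop 1)).exists_forall_of_atTop
  have hsol : ∀ H, Y₀ ≤ H → ∃ (p u : Fin 3 → ℤ) (Y : ℝ), dotProduct u p = 1 ∧ ‖p‖ ≤ H ∧ H ≤ Y ∧
      |quadForm ξ p| = Y ^ (-w) := fun H hH => by
    obtain ⟨⟨⟨v, hv, h0, h1⟩, -⟩, h3⟩ := hY₀ H hH
    exact exists_primitive_solution hw0 (by linarith) hv h0 h1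
  have hY₀1 : 1 ≤ Y₀ := (hY₀ Y₀ le_rfl).2
  have hcross : ∀ (p q u : Fin 3 → ℤ) (Y Z : ℝ), Y₀ ≤ Y → 2 * Y ≤ Z → dotProduct u p = 1 →
      |quadForm ξ p| = Y ^ (-w) → |quadForm ξ q| = Z ^ (-w) → crossProduct p q ≠ 0 := by
    intro p q u Y Z hY hZ hu hp hq
    refine cross_ne_zero_of_abs_quadForm_lt (ξ := ξ) hu ?_ ?_
    · rw [hq]; exact Real.rpow_pos_of_pos (by linarith) _
    · rw [hp, hq]; exact Real.rpow_lt_rpow_of_neg (by linarith) (by linarith) (by linarith)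
  obtain ⟨p, u, Y, hu, hpH, hHY, hpL⟩ := hsol Y₀ le_rfl
  obtain ⟨q, u', Z, hu', hqH, hHZ, hqL⟩ := hsol (2 * Y) (by linarith)
  have hn := hcross p q u Y Z hHY hHZ hu hpL hqL
  set n := crossProduct p q with hn_def
  -- all later solutions stay in the plane of the first two
  have hchain : ∀ k : ℕ, ∃ (p q u u' : Fin 3 → ℤ) (Y Z : ℝ), Y₀ ≤ Y ∧ (2 : ℝ) ^ k ≤ Y ∧
      2 * Y ≤ Z ∧ dotProduct u p = 1 ∧ dotProduct u' q = 1 ∧ ‖p‖ ≤ Y ∧ ‖q‖ ≤ 2 * Y ∧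
      |quadForm ξ p| = Y ^ (-w) ∧ |quadForm ξ q| = Z ^ (-w) ∧
      dotProduct n p = 0 ∧ dotProduct n q = 0 := by
    intro k
    induction k with
    | zero =>
      refine ⟨p, q, u, u', Y, Z, hHY, by simpa using hY₀1.trans hHY, hHZ, hu, hu',
        hpH.trans hHY, hqH, hpL, hqL, ?_, ?_⟩
      · rw [dotProduct_comm, dot_self_cross]
      · rw [dotProduct_comm, dot_cross_self]
    | succ k ih =>
      obtain ⟨p, q, u, u', Y, Z, h1, h2, h3, h4, h5, h6, h7, h8, h9, h10, h11⟩ := ih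
      obtain ⟨r, u'', W, hu'', hrH, hHW, hrL⟩ := hsol (2 * Z) (by linarith)
      refine ⟨q, r, u', u'', Z, W, by linarith, by rw [pow_succ]; linarith, hHW, h5, hu'',
        by linarith, hrH, h9, hrL, h11, ?_⟩
      have hY0 : 0 < Y := by linarith
      have hZ0 : 0 < Z := by linarith
      -- Three successive solutions have an integer determinant at most `24 * Y ^ (1 - w) * Z`, and
      -- the growth bound on `Z` brings this below `1`.
      have hdet : dotProduct (crossProduct p q) r = 0 := by
        rw [← Int.abs_lt_one_iff]
        have hb := abs_tripleProduct_le ξ p q r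
        have l2 : |quadForm ξ q| ≤ Y ^ (-w) := by
          rw [h9]; exact Real.rpow_le_rpow_of_nonpos hY0 (by linarith) (by linarith)
        have l3 : |quadForm ξ r| ≤ Y ^ (-w) := by
          rw [hrL]; exact Real.rpow_le_rpow_of_nonpos hY0 (by linarith) (by linarith)
        have m1 : ‖q‖ * ‖r‖ ≤ (2 * Y) * (2 * Z) := by gcongr
        have m2 : ‖p‖ * ‖r‖ ≤ (2 * Y) * (2 * Z) := by gcongr; linarith
        have m3 : ‖p‖ * ‖q‖ ≤ (2 * Y) * (2 * Z) := by gcongr <;> linarith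
        have hZb := hgrow q Y Z hY0 hZ0 h7 h9
        have hlt1 := (hY₀ Y h1).1.2
        have hYw : 0 < Y ^ (-w) := by positivity
        have : |((dotProduct (crossProduct p q) r : ℤ) : ℝ)| < 1 := by
          calc _ ≤ 2 * (Y ^ (-w) * ((2 * Y) * (2 * Z)) + Y ^ (-w) * ((2 * Y) * (2 * Z)) +
                  Y ^ (-w) * ((2 * Y) * (2 * Z))) := by
                refine hb.trans ?_
                rw [h8]
                gcongr
            _ = 24 * (Y ^ (-w) * Y) * Z := by ring
            _ ≤ 24 * (Y ^ (-w) * Y) * (C * Y ^ (w' / w)) := by gcongr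
            _ = 24 * C * Y ^ (w' / w - (w - 1)) := by
                rw [show w' / w - (w - 1) = -w + 1 + w' / w by ring, Real.rpow_add hY0,
                  Real.rpow_add hY0, Real.rpow_one]
                ring
            _ < 1 := hlt1
        exact_mod_cast this
      refine dot_eq_zero_of_cross_eq_zero (hcross p q u Y Z h1 h3 h4 h8 h9) ?_ hdet
      have := cross_cross_eq_smul_sub_smul p q n
      rw [this, dotProduct_comm p n, dotProduct_comm q n, h10, h11]
      simp
  obtain ⟨κ, hκ, hκ'⟩ := exists_pos_le_of_cross_eq_zero hξ hn
  have hlim2 : ∀ᶠ k : ℕ in atTop, 4 * ((2 : ℝ) ^ k) ^ (-(w - 1)) < κ := by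
    have h1 := (tendsto_rpow_neg_atTop (show 0 < w - 1 by linarith)).comp
      (tendsto_pow_atTop_atTop_of_one_lt (one_lt_two : (1 : ℝ) < 2))
    have := h1.const_mul 4
    rw [mul_zero] at this
    exact this.eventually_lt_const hκ
  obtain ⟨k, hk⟩ := hlim2.exists
  obtain ⟨p, q, u, u', Y, Z, h1, h2, h3, h4, h5, h6, h7, h8, h9, h10, h11⟩ := hchain k
  have hY0 : 0 < Y := by linarith
  -- Far along the chain, the nonzero vector `p × q` is parallel to the fixed `n` yet arbitrarily
  -- close to the direction `(1, ξ, ξ ^ 2)`, contradicting `κ`.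
  have hsmall : |quadForm ξ p| * ‖q‖ + |quadForm ξ q| * ‖p‖ < κ := by
    have l2 : |quadForm ξ q| ≤ Y ^ (-w) := by
      rw [h9]; exact Real.rpow_le_rpow_of_nonpos hY0 (by linarith) (by linarith)
    calc _ ≤ Y ^ (-w) * (2 * Y) + Y ^ (-w) * (2 * Y) := by
          rw [h8]; gcongr; linarith
      _ = 4 * Y ^ (-(w - 1)) := by
          rw [show -(w - 1) = -w + 1 by ring, Real.rpow_add hY0, Real.rpow_one]; ring
      _ ≤ 4 * ((2 : ℝ) ^ k) ^ (-(w - 1)) := by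
          gcongr 4 * ?_
          exact Real.rpow_le_rpow_of_nonpos (by positivity) h2 (by linarith)
      _ < κ := hk
  have hpar : crossProduct (crossProduct p q) n = 0 := by
    rw [cross_cross_eq_smul_sub_smul p q n, dotProduct_comm p n, dotProduct_comm q n, h10, h11]
    simp
  have hb := abs_cross_sub_le ξ p q
  rcases hκ' _ (hcross p q u Y Z h1 h3 h4 h8 h9) hpar with h' | h' <;> linarith [hb.1, hb.2]

/-! ### Mahler measure and passage to irreducible factors. -/

/-- The Mahler measure of an integer polynomial. -/
noncomputable def intMahler (P : ℤ[X]) : ℝ := (P.map (Int.castRingHom ℂ)).mahlerMeasure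

theorem isometry_intCast_complex : Isometry (Int.castRingHom ℂ) :=
  AddMonoidHomClass.isometry_of_norm (Int.castRingHom ℂ) fun n => by
    simp [Int.norm_eq_abs]

theorem intMahler_mul (P Q : ℤ[X]) : intMahler (P * Q) = intMahler P * intMahler Q := by
  simp [intMahler, Polynomial.map_mul, mahlerMeasure_mul]

theorem one_le_intMahler {P : ℤ[X]} (hP : P ≠ 0) : 1 ≤ intMahler P :=
  one_le_mahlerMeasure_of_ne_zero hP

theorem intMahler_le_of_dvd {P Q : ℤ[X]} (h : P ∣ Q) (hQ : Q ≠ 0) : intMahler P ≤ intMahler Q := by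
  obtain ⟨S, rfl⟩ := h
  have hS := one_le_intMahler (right_ne_zero_of_mul hQ)
  have hP := one_le_intMahler (left_ne_zero_of_mul hQ)
  rw [intMahler_mul]
  nlinarith

theorem supNorm_le_intMahler {P : ℤ[X]} {n : ℕ} (hn : P.natDegree ≤ n) :
    P.supNorm ≤ 2 ^ n * intMahler P := by
  obtain ⟨i, hi⟩ := P.exists_eq_supNorm
  rw [hi]
  refine (norm_coeff_le_choose_mul_mapMahlerMeasure _ isometry_intCast_complex i P).trans ?_
  have h1 : ((P.natDegree.choose i : ℕ) : ℝ) ≤ 2 ^ n := by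
    exact_mod_cast (Nat.choose_le_two_pow _ _).trans (Nat.pow_le_pow_right two_pos hn)
  exact mul_le_mul_of_nonneg_right h1 (mahlerMeasure_nonneg _)

theorem intMahler_le_supNorm {P : ℤ[X]} {n : ℕ} (hn : P.natDegree ≤ n) :
    intMahler P ≤ (n + 1) * P.supNorm := by
  refine (mapMahlerMeasure_le_sum_norm_coeff P _ isometry_intCast_complex).trans ?_
  rw [sum_over_range _ (by simp)]
  calc _ ≤ ∑ i ∈ Finset.range (P.natDegree + 1), P.supNorm :=
        Finset.sum_le_sum fun i _ => P.le_supNorm i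
    _ = (P.natDegree + 1) * P.supNorm := by simp
    _ ≤ _ := by
        gcongr
        exact P.supNorm_nonneg

theorem one_le_supNorm {P : ℤ[X]} (hP : P ≠ 0) : 1 ≤ P.supNorm := by
  refine le_trans ?_ (P.le_supNorm P.natDegree)
  rw [Int.norm_eq_abs]
  exact_mod_cast Int.one_le_abs (leadingCoeff_ne_zero.2 hP)

theorem aeval_ne_zero_of_transcendental {ξ : ℝ} (hξ : Transcendental ℚ ξ) {P : ℤ[X]} (hP : P ≠ 0) :
    aeval ξ P ≠ 0 := fun h =>
  hξ (IsAlgebraic.extendScalars (algebraMap ℤ ℚ).injective_int ⟨P, hP, h⟩)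

/-- Good polynomial approximations yield equally good irreducible ones of large height. -/
theorem exists_irreducible_of_forall_exists_small {ξ : ℝ} (hξ : Transcendental ℚ ξ) {s : ℝ}
    (hs : 0 < s) {n : ℕ} (h : ∀ ε > 0, ∃ P : ℤ[X], P ≠ 0 ∧ P.natDegree ≤ n ∧
      |aeval ξ P| * intMahler P ^ s < ε) (B : ℝ) :
    ∃ R : ℤ[X], Irreducible R ∧ R.natDegree ≠ 0 ∧ R.natDegree ≤ n ∧ B < intMahler R ∧
      |aeval ξ R| * intMahler R ^ s < 1 := by
  by_contra! hcon
  -- By Northcott finiteness, the nonzero polynomials of measure at most `B` share a positive lower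
  -- bound `c`.
  have hF := finite_mahlerMeasure_le n B.toNNReal
  have hc : ∀ᶠ c : ℝ in nhdsWithin 0 (Set.Ioi 0),
      ∀ P ∈ {p : ℤ[X] | p.natDegree ≤ n ∧
        (p.map (Int.castRingHom ℂ)).mahlerMeasure ≤ B.toNNReal},
        P ≠ 0 → c ≤ |aeval ξ P| * intMahler P ^ s := by
    rw [eventually_all_finite hF]
    intro P _
    by_cases hP : P = 0
    · simp [hP]
    · have hpos : 0 < |aeval ξ P| * intMahler P ^ s :=
        mul_pos (abs_pos.2 (aeval_ne_zero_of_transcendental hξ hP))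
          (Real.rpow_pos_of_pos (one_pos.trans_le (one_le_intMahler hP)) _)
      filter_upwards [nhdsWithin_le_nhds (Iic_mem_nhds hpos)] with c hc _ using hc
  have hle : ∀ᶠ c : ℝ in nhdsWithin 0 (Set.Ioi 0), c ≤ 1 :=
    nhdsWithin_le_nhds (Iic_mem_nhds zero_lt_one)
  obtain ⟨c, hc, hc1, hc0⟩ := (hc.and (hle.and self_mem_nhdsWithin)).exists
  -- The quantity is multiplicative: constants contribute at least `1` and every nonconstant
  -- irreducible factor at least `c`, hence at least `c` to its degree.
  have key : ∀ a : ℤ[X], a ≠ 0 → a.natDegree ≤ n →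
      c ^ a.natDegree ≤ |aeval ξ a| * intMahler a ^ s := by
    have hconst : ∀ a : ℤ[X], a ≠ 0 → a.natDegree = 0 →
        1 ≤ |aeval ξ a| * intMahler a ^ s := by
      intro a ha hd
      have h1 : 1 ≤ intMahler a ^ s := Real.one_le_rpow (one_le_intMahler ha) hs.le
      have h2 : 1 ≤ |aeval ξ a| := by
        rw [eq_C_of_natDegree_eq_zero hd] at ha ⊢
        rw [aeval_C, eq_intCast]
        exact_mod_cast Int.one_le_abs (by simpa using ha)
      nlinarith
    intro a
    induction a using WfDvdMonoid.induction_on_irreducible with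
    | zero => exact fun h => absurd rfl h
    | unit u hu =>
      intro h0 _
      have := natDegree_eq_zero_of_isUnit hu
      rw [this, pow_zero]
      exact hconst u h0 this
    | mul a i ha hi ih =>
      intro h0 hn
      rw [natDegree_mul hi.ne_zero ha] at hn ⊢
      have h1 := ih ha (by omega)
      have h2 : c ^ i.natDegree ≤ |aeval ξ i| * intMahler i ^ s := by
        by_cases hd : i.natDegree = 0
        · rw [hd, pow_zero]; exact hconst i hi.ne_zero hd
        · refine (pow_le_of_le_one hc0.le hc1 hd).trans ?_
          by_cases hB : B < intMahler i
          · exact hc1.trans (hcon i hi hd (by omega) hB)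
          · refine hc i ⟨by omega, ?_⟩ hi.ne_zero
            exact (not_lt.1 hB).trans (Real.le_coe_toNNReal B)
      rw [map_mul, abs_mul, intMahler_mul, Real.mul_rpow (zero_le_one.trans
        (one_le_intMahler hi.ne_zero)) (zero_le_one.trans (one_le_intMahler ha)), pow_add]
      calc _ ≤ (|aeval ξ i| * intMahler i ^ s) * (|aeval ξ a| * intMahler a ^ s) :=
            mul_le_mul h2 h1 (by positivity) (le_trans (by positivity) h2)
        _ = _ := by ring
  obtain ⟨P, hP, hd, hlt⟩ := h (c ^ n) (by positivity)
  exact absurd ((pow_le_pow_of_le_one hc0.le hc1 hd).trans (key P hP hd)) (not_le.2 hlt)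

/-! ### Resultants and the Sylvester matrix. -/

/-- An irreducible integer polynomial of positive degree not dividing `Q` has nonzero resultant
with `Q`. -/
theorem resultant_ne_zero_of_not_dvd {P Q : ℤ[X]} (hP : Irreducible P) (hd : P.natDegree ≠ 0)
    (h : ¬ P ∣ Q) : resultant P Q ≠ 0 := by
  have hprim := hP.isPrimitive hd
  have hirr := (IsPrimitive.Int.irreducible_iff_irreducible_map_cast hprim).1 hP
  have hcop : IsCoprime (P.map (Int.castRingHom ℚ)) (Q.map (Int.castRingHom ℚ)) := by
    rw [hirr.coprime_iff_not_dvd, ← IsPrimitive.Int.dvd_iff_map_cast_dvd_map_cast _ _ hprim]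
    exact h
  have := resultant_ne_zero _ _ hcop
  rw [natDegree_map_eq_of_injective (Int.castRingHom ℚ).injective_int,
    natDegree_map_eq_of_injective (Int.castRingHom ℚ).injective_int, resultant_map_map] at this
  exact fun h0 => this (by simp [h0])

theorem sum_shifted_coeff_mul_pow {P : ℝ[X]} {m N : ℕ} (x : ℝ) (hm : P.natDegree ≤ m) {j : ℕ}
    (hj : j + m < N) :
    ∑ i : Fin N, x ^ (i : ℕ) * (if (i : ℕ) ∈ Set.Icc j (j + m) then P.coeff (i - j) else 0) =
      x ^ j * P.eval x := by
  rw [Fin.sum_univ_eq_sum_range (fun i => x ^ i * (if i ∈ Set.Icc j (j + m) then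
    P.coeff (i - j) else 0)) N, eval_eq_sum_range' (Nat.lt_succ_of_le hm), Finset.mul_sum]
  symm
  refine Finset.sum_of_injOn (fun i => j + i) (fun a _ b _ hab => by simpa using hab) ?_ ?_ ?_
  · intro i hi
    simp only [Finset.coe_range, Set.mem_Iio] at hi ⊢
    omega
  · intro i _ hi
    rw [if_neg, mul_zero]
    rintro ⟨h1, h2⟩
    exact hi ⟨i - j, by simp only [Finset.coe_range, Set.mem_Iio]; omega, by simp only; omega⟩
  · intro i hi
    have := Finset.mem_range.1 hi
    rw [if_pos ⟨by omega, by omega⟩, Nat.add_sub_cancel_left, pow_add]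
    ring

/-- The columns of the Sylvester matrix are shifted coefficient vectors, so pairing them with the
powers of `x` evaluates the polynomials. -/
theorem vecMul_sylvester (P Q : ℝ[X]) (x : ℝ) {m n : ℕ} (hm : P.natDegree ≤ m)
    (hn : Q.natDegree ≤ n) :
    (∑ i : Fin (m + n), x ^ (i : ℕ) • sylvester P Q m n i) =
      Fin.addCases (fun j : Fin m => x ^ (j : ℕ) * Q.eval x)
        (fun j : Fin n => x ^ (j : ℕ) * P.eval x) := by
  funext j
  rw [Finset.sum_apply]
  induction j using Fin.addCases with
  | left j =>
    simp only [Pi.smul_apply, smul_eq_mul, sylvester, Matrix.of_apply, Fin.addCases_left]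
    exact sum_shifted_coeff_mul_pow x hn (by omega)
  | right j =>
    simp only [Pi.smul_apply, smul_eq_mul, sylvester, Matrix.of_apply, Fin.addCases_right]
    exact sum_shifted_coeff_mul_pow x hm (by omega)

/-- Two integer polynomials with nonzero resultant cannot both be small at `ξ`. -/
theorem one_le_of_resultant_ne_zero {ξ : ℝ} {P Q : ℤ[X]} (h : resultant P Q ≠ 0)
    (hP : P ≠ 0) (hQ : Q ≠ 0) (hd : P.natDegree ≠ 0) (hξ : aeval ξ P ≠ 0) :
    1 ≤ ((P.natDegree + Q.natDegree).factorial * max 1 |ξ| ^ (P.natDegree + Q.natDegree)) *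
      (P.supNorm ^ Q.natDegree * Q.supNorm ^ P.natDegree) *
        (|aeval ξ P| / P.supNorm + |aeval ξ Q| / Q.supNorm) := by
  set m := P.natDegree with hm
  set n := Q.natDegree with hn
  set K := max 1 |ξ| with hK
  have hK1 : 1 ≤ K := le_max_left _ _
  have hP1 := one_le_supNorm hP
  have hQ1 := one_le_supNorm hQ
  have hP0 : 0 < P.supNorm := by linarith
  have hQ0 : 0 < Q.supNorm := by linarith
  have hξ0 : 0 < |aeval ξ P| := abs_pos.2 hξ
  set δ := |aeval ξ P| / P.supNorm + |aeval ξ Q| / Q.supNorm with hδ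
  have hδ0 : 0 < δ := by positivity
  let P' := P.map (Int.castRingHom ℝ)
  let Q' := Q.map (Int.castRingHom ℝ)
  have hmP : P'.natDegree ≤ m := natDegree_map_le
  have hnQ : Q'.natDegree ≤ n := natDegree_map_le
  have heP : P'.eval ξ = aeval ξ P := by simp [P', aeval_def, eval_map]
  have heQ : Q'.eval ξ = aeval ξ Q := by simp [Q', aeval_def, eval_map]
  let M := sylvester P' Q' m n
  have hMdet : (1 : ℝ) ≤ |M.det| := by
    have : M.det = ((resultant P Q : ℤ) : ℝ) := by
      rw [← eq_intCast (Int.castRingHom ℝ), ← resultant_map_map]; rfl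
    rw [this]
    exact_mod_cast Int.one_le_abs h
  let z : Fin (m + n) := ⟨0, by omega⟩
  -- Row `0` enters the sum with coefficient `ξ ^ 0 = 1`, so the determinant is unchanged, while the
  -- new row consists of values at `ξ`.
  let N := M.updateRow z (∑ i : Fin (m + n), ξ ^ (i : ℕ) • M i)
  have hN : N.det = M.det := by
    rw [Matrix.det_updateRow_sum]; simp [z]
  -- These row and column scalings bring every entry into `[-1, 1]`, so the determinant is at most
  -- `(m + n)!`.
  let r : Fin (m + n) → ℝ := fun i => if i = z then (K ^ (m + n) * δ)⁻¹ else 1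
  let c : Fin (m + n) → ℝ := Fin.addCases (fun _ => Q.supNorm⁻¹) (fun _ => P.supNorm⁻¹)
  let A : Matrix (Fin (m + n)) (Fin (m + n)) ℝ :=
    Matrix.of fun i j => r i * (Matrix.of fun i j => c j * N i j) i j
  have hA : A.det = (∏ i, r i) * ((∏ i, c i) * N.det) := by
    rw [← Matrix.det_mul_row, ← Matrix.det_mul_column]
  have hr : ∏ i, r i = (K ^ (m + n) * δ)⁻¹ := by simp [r, Finset.prod_ite_eq']
  have hc : ∏ i, c i = Q.supNorm⁻¹ ^ m * P.supNorm⁻¹ ^ n := by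
    rw [Fin.prod_univ_add]; simp [c]
  have hpow : ∀ j : ℕ, j ≤ m + n → |ξ ^ j| ≤ K ^ (m + n) := fun j hj => by
    rw [abs_pow]
    exact (pow_le_pow_left₀ (abs_nonneg _) (le_max_right _ _) _).trans
      (pow_le_pow_right₀ hK1 hj)
  have hentry : ∀ i j, |A i j| ≤ 1 := by
    intro i j
    simp only [A, Matrix.of_apply]
    by_cases hi : i = z
    · have hNi : N i = Fin.addCases (fun j : Fin m => ξ ^ (j : ℕ) * Q'.eval ξ)
          (fun j : Fin n => ξ ^ (j : ℕ) * P'.eval ξ) := by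
        rw [← vecMul_sylvester P' Q' ξ hmP hnQ, hi]
        exact Matrix.updateRow_self
      rw [hNi]
      have hb : ∀ (j : ℕ) (t s : ℝ), j ≤ m + n → 0 < s → |t| / s ≤ δ →
          |r i * (s⁻¹ * (ξ ^ j * t))| ≤ 1 := by
        intro j t s hj hs ht
        simp only [r, hi, if_true]
        rw [abs_mul, abs_inv, abs_of_pos (by positivity : 0 < K ^ (m + n) * δ),
          inv_mul_le_one₀ (by positivity), abs_mul, abs_inv, abs_of_pos hs, abs_mul]
        calc s⁻¹ * (|ξ ^ j| * |t|) = |ξ ^ j| * (|t| / s) := by ring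
          _ ≤ _ := by
            gcongr
            exact hpow j hj
      induction j using Fin.addCases with
      | left j =>
        simp only [c, Fin.addCases_left, heQ]
        exact hb _ _ _ (by omega) hQ0 (le_add_of_nonneg_left (by positivity))
      | right j =>
        simp only [c, Fin.addCases_right, heP]
        exact hb _ _ _ (by omega) hP0 (le_add_of_nonneg_right (by positivity))
    · have hNi : N i = M i := Matrix.updateRow_ne hi
      have hcoef : ∀ (R : ℤ[X]) (p : Prop) [Decidable p] (k : ℕ), 0 < R.supNorm →
          |R.supNorm⁻¹ * (if p then (R.map (Int.castRingHom ℝ)).coeff k else 0)| ≤ 1 := by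
        intro R p _ k hR
        rw [abs_mul, abs_inv, abs_of_pos hR, inv_mul_le_one₀ hR]
        split_ifs
        · have := R.le_supNorm k
          rw [Int.norm_eq_abs] at this
          simpa using this
        · simpa using hR.le
      simp only [r, if_neg hi, one_mul, hNi]
      induction j using Fin.addCases with
      | left j =>
        simp only [c, M, sylvester, Matrix.of_apply, Fin.addCases_left]
        exact hcoef Q _ _ hQ0
      | right j =>
        simp only [c, M, sylvester, Matrix.of_apply, Fin.addCases_right]
        exact hcoef P _ _ hP0
  have hdet := Matrix.det_le (abv := AbsoluteValue.abs) (A := A) (x := 1) hentry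
  rw [AbsoluteValue.abs_apply, hA, hr, hc, hN, abs_mul, abs_mul, one_pow, Fintype.card_fin,
    nsmul_eq_mul, mul_one, abs_of_pos (by positivity), abs_of_pos (by positivity)] at hdet
  rw [inv_pow, inv_pow, ← mul_inv, ← mul_assoc, ← mul_inv, inv_mul_le_iff₀ (by positivity)] at hdet
  calc (1 : ℝ) ≤ |M.det| := hMdet
    _ ≤ _ := hdet
    _ = _ := by ring

/-! ### Irreducible approximations of degree at most two to extremal numbers. -/

theorem aeval_eq_quadForm (ξ : ℝ) {P : ℤ[X]} (hP : P.natDegree ≤ 2) :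
    aeval ξ P = quadForm ξ fun i => P.coeff i := by
  rw [aeval_eq_sum_range' (Nat.lt_succ_of_le hP)]
  simp [Finset.sum_range_succ, quadForm]

theorem exists_polynomial_of_vector (ξ : ℝ) (v : Fin 3 → ℤ) :
    ∃ P : ℤ[X], P.natDegree ≤ 2 ∧ aeval ξ P = quadForm ξ v ∧ P.supNorm ≤ ‖v‖ := by
  have hcoeff : ∀ i : ℕ, (C (v 2) * X ^ 2 + C (v 1) * X + C (v 0)).coeff i =
      if h : i < 3 then v ⟨i, h⟩ else 0 := by
    intro i
    simp only [coeff_add, coeff_C_mul, coeff_X_pow, coeff_X, coeff_C]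
    match i with
    | 0 => simp
    | 1 => simp
    | 2 => simp
    | i + 3 => simp
  refine ⟨C (v 2) * X ^ 2 + C (v 1) * X + C (v 0), natDegree_quadratic_le, ?_, ?_⟩
  · simp [quadForm]; ring
  · obtain ⟨i, hi⟩ := (C (v 2) * X ^ 2 + C (v 1) * X + C (v 0)).exists_eq_supNorm
    rw [hi, hcoeff]
    split_ifs
    · exact norm_le_pi_norm v _
    · simp

/-- An extremal number has irreducible approximations of degree at most two, of arbitrarily large
height `h` and of quality `h ^ (-4.1)`. -/
theorem IsExtremalNumber.exists_irreducible {ξ : ℝ} (hξ : IsExtremalNumber ξ) (B : ℝ) :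
    ∃ P : ℤ[X], Irreducible P ∧ P.natDegree ≠ 0 ∧ P.natDegree ≤ 2 ∧ B ≤ P.supNorm ∧
      |aeval ξ P| ≤ P.supNorm ^ (-4.1 : ℝ) := by
  obtain ⟨htr, hw⟩ := hξ
  have hirr : Irrational ξ := by
    rintro ⟨q, rfl⟩
    exact htr (isAlgebraic_algebraMap q)
  have h26 : ((2.6 : ℝ) : EReal) < wHat 2 ξ := by
    rw [hw, EReal.coe_lt_coe_iff]
    have : (2.2 : ℝ) < √5 := Real.lt_sqrt_of_sq_lt (by norm_num)
    linarith
  obtain ⟨x, ⟨w, rfl, hev⟩, hlt⟩ := lt_sSup_iff.1 h26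
  rw [EReal.coe_lt_coe_iff] at hlt
  have hvec : ∀ᶠ H : ℝ in atTop, ∃ v : Fin 3 → ℤ, ‖v‖ ≤ H ∧ 0 < |quadForm ξ v| ∧
      |quadForm ξ v| ≤ H ^ (-w) := by
    filter_upwards [hev, eventually_ge_atTop 0] with H hH h0
    obtain ⟨P, hd, hh, h1, h2⟩ := hH
    rw [aeval_eq_quadForm ξ hd] at h1 h2
    exact ⟨_, (pi_norm_le_iff_of_nonneg h0).2 fun i => (P.le_supNorm i).trans hh, h1, h2⟩
  have hpoly : ∀ ε > 0, ∃ P : ℤ[X], P ≠ 0 ∧ P.natDegree ≤ 2 ∧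
      |aeval ξ P| * intMahler P ^ (4.15 : ℝ) < ε := by
    intro ε hε
    -- `w > 2.6` gives `w * (w - 1) > 4.16`. The later drop from `4.15` to `4.1` absorbs the
    -- constant relating Mahler measure and height.
    obtain ⟨v, h0, h1⟩ := exists_abs_quadForm_mul_norm_rpow_lt hirr (w := w) (w' := 4.15)
      (by linarith) (by norm_num) (by nlinarith) hvec
      (show 0 < ε / 3 ^ (4.15 : ℝ) by positivity)
    obtain ⟨P, hd, he, hh⟩ := exists_polynomial_of_vector ξ v
    have hP : P ≠ 0 := by rintro rfl; simp [← he] at h0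
    refine ⟨P, hP, hd, ?_⟩
    rw [lt_div_iff₀ (by positivity)] at h1
    refine lt_of_le_of_lt ?_ h1
    rw [he, mul_assoc, mul_comm (‖v‖ ^ _), ← Real.mul_rpow (by norm_num) (norm_nonneg _)]
    gcongr
    · exact mahlerMeasure_nonneg _
    · refine (intMahler_le_supNorm hd).trans ?_
      norm_num
      exact hh
  have hlim : ∀ᶠ M : ℝ in atTop, 4 ^ (4.1 : ℝ) * M ^ (-0.05 : ℝ) < 1 := by
    have := (tendsto_rpow_neg_atTop (show (0 : ℝ) < 0.05 by norm_num)).const_mul (4 ^ (4.1 : ℝ))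
    rw [mul_zero] at this
    exact this.eventually_lt_const one_pos
  obtain ⟨M₀, hM₀⟩ := hlim.exists_forall_of_atTop
  obtain ⟨P, hP, hd0, hd, hM, hlt1⟩ :=
    exists_irreducible_of_forall_exists_small htr (by norm_num) hpoly (max M₀ (3 * B))
  have hM1 := one_le_intMahler hP.ne_zero
  have hM0 : 0 < intMahler P := by linarith
  have hs1 := one_le_supNorm hP.ne_zero
  have hs0 : 0 < P.supNorm := by linarith
  refine ⟨P, hP, hd0, hd, ?_, ?_⟩
  · have h1 := (le_max_right M₀ (3 * B)).trans hM.le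
    have h2 := intMahler_le_supNorm hd
    norm_num at h2
    linarith
  · have h1 : P.supNorm ^ (4.1 : ℝ) ≤ 4 ^ (4.1 : ℝ) * intMahler P ^ (4.1 : ℝ) := by
      rw [← Real.mul_rpow (by norm_num) hM0.le]
      gcongr
      convert supNorm_le_intMahler hd using 2
      norm_num
    have h2 := hM₀ _ ((le_max_left _ _).trans hM.le)
    have h3 : |aeval ξ P| ≤ intMahler P ^ (-4.15 : ℝ) := by
      rw [Real.rpow_neg hM0.le, ← one_div, le_div_iff₀ (by positivity)]
      exact hlt1.le
    rw [Real.rpow_neg hs0.le, ← one_div, le_div_iff₀ (by positivity)]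
    calc _ ≤ intMahler P ^ (-4.15 : ℝ) * (4 ^ (4.1 : ℝ) * intMahler P ^ (4.1 : ℝ)) := by gcongr
      _ = 4 ^ (4.1 : ℝ) * intMahler P ^ (-0.05 : ℝ) := by
        rw [show (-0.05 : ℝ) = -4.15 + 4.1 by norm_num, Real.rpow_add hM0]; ring
      _ ≤ 1 := h2.le

/-! ### The two upper bounds in degree three. -/

/-- An irreducible polynomial of degree at most two and a cubic polynomial not divisible by it
cannot both be small at `ξ`. -/
theorem exists_one_le_of_not_dvd {ξ : ℝ} (hξ : Transcendental ℚ ξ) :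
    ∃ C : ℝ, 0 < C ∧ ∀ P Q : ℤ[X], Irreducible P → P.natDegree ≠ 0 → P.natDegree ≤ 2 → Q ≠ 0 →
      Q.natDegree ≤ 3 → ¬ P ∣ Q →
      1 ≤ C * (P.supNorm ^ 2 * Q.supNorm ^ 2 * |aeval ξ P| +
        P.supNorm ^ 3 * Q.supNorm * |aeval ξ Q|) := by
  refine ⟨(Nat.factorial 5) * max 1 |ξ| ^ 5, by positivity, fun P Q hP hd0 hd hQ hdQ hdvd => ?_⟩
  have hP1 := one_le_supNorm hP.ne_zero
  have hQ1 := one_le_supNorm hQ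
  have hP0 : 0 < P.supNorm := by linarith
  have hQ0 : 0 < Q.supNorm := by linarith
  refine (one_le_of_resultant_ne_zero (resultant_ne_zero_of_not_dvd hP hd0 hdvd) hP.ne_zero hQ hd0
    (aeval_ne_zero_of_transcendental hξ hP.ne_zero)).trans ?_
  calc _ ≤ ((Nat.factorial 5) * max 1 |ξ| ^ 5) * (P.supNorm ^ 3 * Q.supNorm ^ 2) *
        (|aeval ξ P| / P.supNorm + |aeval ξ Q| / Q.supNorm) := by
        gcongr
        · omega
        · exact le_max_left _ _
        · omega
    _ = _ := by field_simp

/-- Gelfond's inequality through the Mahler measure; `16 = 2 ^ 2 * (3 + 1)`. -/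
theorem supNorm_le_of_dvd {P Q : ℤ[X]} (hd : P.natDegree ≤ 2) (hQ : Q ≠ 0) (hdQ : Q.natDegree ≤ 3)
    (h : P ∣ Q) : P.supNorm ≤ 16 * Q.supNorm := by
  have h1 := supNorm_le_intMahler hd
  have h2 := intMahler_le_supNorm hdQ
  have h3 := intMahler_le_of_dvd h hQ
  norm_num at h1 h2
  linarith

theorem IsExtremalNumber.wHat_three_le {ξ : ℝ} (hξ : IsExtremalNumber ξ) : wHat 3 ξ ≤ 4 := by
  refine sSup_le ?_
  rintro _ ⟨w, rfl, hev⟩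
  rw [show (4 : EReal) = ((4 : ℝ) : EReal) from rfl, EReal.coe_le_coe_iff]
  by_contra! hw
  obtain ⟨C, hC, hres⟩ := exists_one_le_of_not_dvd hξ.1
  have hlim : ∀ᶠ H : ℝ in atTop, C * (17 ^ (-2.1 : ℝ) * H ^ (-0.1 : ℝ)) +
      C * (17 ^ 3 * H ^ (-(w - 4))) < 1 := by
    have h1 := ((tendsto_rpow_neg_atTop (show (0 : ℝ) < 0.1 by norm_num)).const_mul
      (17 ^ (-2.1 : ℝ))).const_mul C
    have h2 := ((tendsto_rpow_neg_atTop (show 0 < w - 4 by linarith)).const_mul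
      (17 ^ 3)).const_mul C
    have := h1.add h2
    simp only [mul_zero, add_zero] at this
    exact this.eventually_lt_const one_pos
  obtain ⟨H₀, hH₀⟩ := ((hev.and hlim).and (eventually_ge_atTop 1)).exists_forall_of_atTop
  obtain ⟨P, hP, hd0, hd, hB, hsmall⟩ := hξ.exists_irreducible (17 * H₀)
  -- Since `17 > 16`, `P` is too tall to divide any nonzero cubic of height at most `H`, while `H`
  -- stays comparable to its height. The resultant terms are then `O(H ^ (-0.1))` and `O(H ^ (-(w -
  -- 4)))`.
  obtain ⟨H, hH⟩ : ∃ H, P.supNorm = 17 * H := ⟨P.supNorm / 17, by ring⟩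
  obtain ⟨⟨⟨Q, hdQ, hQH, hQ0, hQ1⟩, hlt⟩, hH1⟩ := hH₀ H (by linarith)
  have hQ : Q ≠ 0 := by rintro rfl; simp at hQ0
  have hH0 : 0 < H := by linarith
  have hdvd : ¬ P ∣ Q := fun h => by
    have := supNorm_le_of_dvd hd hQ hdQ h
    linarith
  have hmain := hres P Q hP hd0 hd hQ hdQ hdvd
  refine absurd hmain (not_le.2 (lt_of_le_of_lt ?_ hlt))
  rw [← mul_add]
  have hQn := Q.supNorm_nonneg
  rw [hH] at hsmall ⊢
  gcongr C * (?_ + ?_)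
  · calc (17 * H) ^ 2 * Q.supNorm ^ 2 * |aeval ξ P|
        ≤ (17 * H) ^ 2 * H ^ 2 * (17 * H) ^ (-4.1 : ℝ) := by gcongr
      _ = _ := by
        rw [Real.mul_rpow (by norm_num) hH0.le, show (-4.1 : ℝ) = -2.1 + -2 by norm_num,
          Real.rpow_add (by norm_num), show (-0.1 : ℝ) = (-2.1 + -2) + 4 by norm_num,
          Real.rpow_add hH0 (-2.1 + -2) 4, Real.rpow_neg (by norm_num) 2]
        norm_cast
        field_simp
        norm_num
  · calc (17 * H) ^ 3 * Q.supNorm * |aeval ξ Q| ≤ (17 * H) ^ 3 * H * H ^ (-w) := by gcongr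
      _ = _ := by
        rw [show -(w - 4) = -w + 4 by ring, Real.rpow_add hH0]
        norm_cast
        ring

theorem abs_aeval_le_of_aeval_eq_zero {ξ : ℝ} {α : ℂ} {P : ℤ[X]} (hd : P.natDegree ≤ 3)
    (hα : aeval α P = 0) (hdist : ‖(ξ : ℂ) - α‖ ≤ 1) :
    |aeval ξ P| ≤ 6 * (|ξ| + 1) ^ 2 * P.supNorm * ‖(ξ : ℂ) - α‖ := by
  have hcoeff : ∀ i, ‖(P.coeff i : ℂ)‖ ≤ P.supNorm := fun i => by
    simpa [Int.norm_eq_abs] using P.le_supNorm i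
  have hs := P.supNorm_nonneg
  have e : ((aeval ξ P : ℝ) : ℂ) = ((ξ : ℂ) - α) * (P.coeff 1 + P.coeff 2 * (ξ + α) +
      P.coeff 3 * (ξ ^ 2 + ξ * α + α ^ 2)) := by
    rw [aeval_eq_sum_range' (Nat.lt_succ_of_le hd)] at hα ⊢
    simp only [Finset.sum_range_succ, Finset.sum_range_zero, zsmul_eq_mul] at hα ⊢
    push_cast
    linear_combination hα
  have hξR : ‖(ξ : ℂ)‖ ≤ |ξ| + 1 := by
    rw [Complex.norm_real, Real.norm_eq_abs]; linarith
  have hαR : ‖α‖ ≤ |ξ| + 1 := by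
    have := norm_sub_norm_le α (ξ : ℂ)
    rw [norm_sub_rev, Complex.norm_real, Real.norm_eq_abs] at this
    linarith
  set R := |ξ| + 1 with hR
  have hR1 : 1 ≤ R := by linarith [abs_nonneg ξ]
  rw [← Real.norm_eq_abs, ← Complex.norm_real, e, norm_mul, mul_comm]
  gcongr
  calc _ ≤ ‖(P.coeff 1 : ℂ)‖ + ‖(P.coeff 2 : ℂ)‖ * (‖(ξ : ℂ)‖ + ‖α‖) +
        ‖(P.coeff 3 : ℂ)‖ * (‖(ξ : ℂ)‖ ^ 2 + ‖(ξ : ℂ)‖ * ‖α‖ + ‖α‖ ^ 2) := by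
        refine (norm_add₃_le).trans ?_
        rw [norm_mul, norm_mul]
        gcongr
        · exact norm_add_le _ _
        · refine (norm_add₃_le).trans ?_
          rw [norm_mul, norm_pow, norm_pow]
    _ ≤ P.supNorm + P.supNorm * (R + R) + P.supNorm * (R ^ 2 + R * R + R ^ 2) := by
        gcongr <;> exact hcoeff _
    _ = P.supNorm * (1 + 2 * R + 3 * R ^ 2) := by ring
    _ ≤ P.supNorm * (6 * R ^ 2) := by gcongr; nlinarith
    _ = _ := by ring

theorem natDegree_intMinpoly {α : ℂ} (hα : IsAlgebraic ℚ α) :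
    (intMinpoly α).natDegree = (minpoly ℚ α).natDegree := by
  rw [← natDegree_map_eq_of_injective (Int.castRingHom ℚ).injective_int]
  exact natDegree_eq_of_degree_eq (degree_eq_degree_of_associated (intMinpoly_map hα))

theorem IsExtremalNumber.wHatStar_three_le {ξ : ℝ} (hξ : IsExtremalNumber ξ) :
    wHatStar 3 ξ ≤ ((3.92 : ℝ) : EReal) := by
  refine sSup_le ?_
  rintro _ ⟨w, rfl, hev⟩
  rw [EReal.coe_le_coe_iff]
  by_contra! hw
  obtain ⟨C, hC, hres⟩ := exists_one_le_of_not_dvd hξ.1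
  obtain ⟨C₁, hC₁1, hlip⟩ : ∃ C₁ : ℝ, 1 ≤ C₁ ∧ ∀ (α : ℂ) (P : ℤ[X]), P.natDegree ≤ 3 →
      aeval α P = 0 → ‖(ξ : ℂ) - α‖ ≤ 1 → |aeval ξ P| ≤ C₁ * P.supNorm * ‖(ξ : ℂ) - α‖ :=
    ⟨6 * (|ξ| + 1) ^ 2, by nlinarith [abs_nonneg ξ], fun _ _ => abs_aeval_le_of_aeval_eq_zero⟩
  -- The factor `17`, again above `16`, makes the case `P ∣ Q` end in `δ ≤ 16 / 17 * δ`.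
  obtain ⟨D, hD⟩ : ∃ D, D = 17 * C₁ := ⟨_, rfl⟩
  have hD1 : 1 ≤ D := by linarith
  -- Up to constants, `H(P) ≤ t ^ a` and `H(Q) ≤ t ^ b`, with both values at most `t⁻¹`. The
  -- resultant bound fails once `2 * a + 2 * b < 1` and `3 * a + b < 1`; the first sum is about
  -- `0.998`.
  set a : ℝ := (4.1)⁻¹ with ha
  set b : ℝ := (3.92)⁻¹ with hb
  have hb0 : 0 < b := by norm_num [hb]
  -- the parameter is `t = 1 / |P(ξ)|`, and solutions are sought of height at most `(D * t) ^ b`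
  have hlim : ∀ᶠ t : ℝ in atTop, C * ((D ^ b) ^ 2 * t ^ (-(1 - 2 * a - 2 * b))) +
      C * (D ^ b * t ^ (-(1 - 3 * a - b))) < 1 := by
    have h1 := ((tendsto_rpow_neg_atTop (show 0 < 1 - 2 * a - 2 * b by
      norm_num [ha, hb])).const_mul ((D ^ b) ^ 2)).const_mul C
    have h2 := ((tendsto_rpow_neg_atTop (show 0 < 1 - 3 * a - b by
      norm_num [ha, hb])).const_mul (D ^ b)).const_mul C
    have := h1.add h2
    simp only [mul_zero, add_zero] at this
    exact this.eventually_lt_const one_pos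
  have htend : Tendsto (fun t : ℝ => (D * t) ^ b) atTop atTop :=
    (tendsto_rpow_atTop hb0).comp (tendsto_id.const_mul_atTop (by linarith))
  obtain ⟨t₀, ht₀⟩ := ((htend.eventually (hev.and (eventually_ge_atTop 1))).and
    (hlim.and (eventually_ge_atTop 1))).exists_forall_of_atTop
  have ht₀1 := (ht₀ t₀ le_rfl).2.2
  obtain ⟨P, hP, hd0, hd, hB, hsmall⟩ := hξ.exists_irreducible t₀
  set δ := |aeval ξ P| with hδ
  have hδ0 : 0 < δ := abs_pos.2 (aeval_ne_zero_of_transcendental hξ.1 hP.ne_zero)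
  have hP1 := one_le_supNorm hP.ne_zero
  have hP0 : 0 < P.supNorm := by linarith
  have hht : P.supNorm ≤ (δ⁻¹) ^ a := by
    rw [Real.rpow_neg hP0.le, le_inv_comm₀ hδ0 (by positivity)] at hsmall
    calc P.supNorm = (P.supNorm ^ (4.1 : ℝ)) ^ a :=
          (Real.rpow_rpow_inv hP0.le (by norm_num)).symm
      _ ≤ _ := by gcongr
  have htt : t₀ ≤ δ⁻¹ := by
    rw [Real.rpow_neg hP0.le, le_inv_comm₀ hδ0 (by positivity)] at hsmall
    refine (hB.trans ?_).trans hsmall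
    conv_lhs => rw [← Real.rpow_one P.supNorm]
    exact Real.rpow_le_rpow_of_exponent_le hP1 (by norm_num)
  obtain ⟨⟨⟨α, hα, hdα, hαH, hα0, hα1⟩, hH1⟩, hlt, ht1⟩ := ht₀ δ⁻¹ htt
  set t := δ⁻¹ with ht
  have ht0 : 0 < t := by linarith
  set H := (D * t) ^ b with hH
  have hHD : H ^ (-w) ≤ δ / D := by
    calc H ^ (-w) ≤ H ^ (-3.92 : ℝ) := Real.rpow_le_rpow_of_exponent_le hH1 (by linarith)
      _ = δ / D := by
        rw [hH, Real.rpow_neg (by positivity), Real.rpow_inv_rpow (by positivity) (by norm_num),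
          ht, mul_inv, inv_inv, mul_comm, div_eq_mul_inv]
  set Q := intMinpoly α with hQdef
  have hQirr : Irreducible Q := irreducible_intMinpoly hα
  have hQ1 := one_le_supNorm hQirr.ne_zero
  have hQ0 : 0 < Q.supNorm := by linarith
  have hdQ : Q.natDegree ≤ 3 := (natDegree_intMinpoly hα).trans_le hdα
  have hαQ : aeval α Q = 0 := aeval_intMinpoly hα
  have hαH' : Q.supNorm ≤ H := hαH
  have hα2 : ‖(ξ : ℂ) - α‖ ≤ Q.supNorm⁻¹ * (δ / D) := by
    refine hα1.trans ?_
    exact mul_le_mul_of_nonneg_left hHD (inv_nonneg.2 hQ0.le)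
  clear_value Q
  have hα3 : ‖(ξ : ℂ) - α‖ ≤ 1 := by
    refine hα2.trans (mul_le_one₀ (inv_le_one_of_one_le₀ hQ1) (by positivity) ?_)
    rw [div_le_one (by linarith)]
    have : δ ≤ 1 := by
      rw [ht] at ht1
      exact (one_le_inv₀ hδ0).1 ht1
    linarith
  -- Both polynomials are irreducible, so divisibility makes `α` a root of `P`, and `|ξ - α|` is too
  -- small for the size of `P(ξ)`.
  have hdvd : ¬ P ∣ Q := fun h => by
    have hle := supNorm_le_of_dvd hd hQirr.ne_zero hdQ h
    have hαP : aeval α P = 0 :=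
      aeval_eq_zero_of_dvd_aeval_eq_zero (hP.associated_of_dvd hQirr h).symm.dvd
        hαQ
    have hb := hlip α P (by omega) hαP hα3
    have : δ ≤ 16 / 17 * δ := by
      calc δ ≤ C₁ * P.supNorm * ‖(ξ : ℂ) - α‖ := hb
        _ ≤ C₁ * (16 * Q.supNorm) * (Q.supNorm⁻¹ * (δ / D)) := by gcongr
        _ = 16 / 17 * δ := by rw [hD]; field_simp
    linarith
  have hQξ : |aeval ξ Q| ≤ δ := by
    calc |aeval ξ Q| ≤ C₁ * Q.supNorm * ‖(ξ : ℂ) - α‖ :=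
          hlip α Q hdQ hαQ hα3
      _ ≤ C₁ * Q.supNorm * (Q.supNorm⁻¹ * (δ / D)) := by gcongr
      _ = δ / 17 := by rw [hD]; field_simp
      _ ≤ δ := by linarith
  have hmain := hres P Q hP hd0 hd hQirr.ne_zero hdQ hdvd
  refine absurd hmain (not_le.2 (lt_of_le_of_lt ?_ hlt))
  have hHe : H = D ^ b * t ^ b := Real.mul_rpow (by linarith) ht0.le
  have hδt : δ = t ^ (-1 : ℝ) := by rw [Real.rpow_neg_one, ht, inv_inv]
  rw [← mul_add]
  clear_value H t a b
  refine mul_le_mul_of_nonneg_left (add_le_add ?_ ?_) hC.le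
  · calc P.supNorm ^ 2 * Q.supNorm ^ 2 * δ ≤ (t ^ a) ^ 2 * H ^ 2 * δ := by
          gcongr
      _ = _ := by
        rw [hHe, hδt, show -(1 - 2 * a - 2 * b) = a + a + b + b + -1 by ring,
          Real.rpow_add ht0, Real.rpow_add ht0, Real.rpow_add ht0, Real.rpow_add ht0]
        ring
  · calc P.supNorm ^ 3 * Q.supNorm * |aeval ξ Q| ≤ (t ^ a) ^ 3 * H * δ := by gcongr
      _ = _ := by
        rw [hHe, hδt, show -(1 - 3 * a - b) = a + a + a + b + -1 by ring,
          Real.rpow_add ht0, Real.rpow_add ht0, Real.rpow_add ht0, Real.rpow_add ht0]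
        ring

theorem corollary2p6 (ξ : ℝ) (hξ : IsExtremalNumber ξ) :
    wHatStar 3 ξ ≤ ((3 * ((2 + √5) / (1 + √5)) : ℝ) : EReal) ∧
      (3.9270 ≤ 3 * ((2 + √5) / (1 + √5)) ∧ 3 * ((2 + √5) / (1 + √5)) < 3.9271) ∧
      wHat 3 ξ ≤ 4 := by
  have h1 : (2.236067 : ℝ) < √5 := Real.lt_sqrt_of_sq_lt (by norm_num)
  have h2 : √5 < (2.236068 : ℝ) := by
    rw [Real.sqrt_lt' (by norm_num)]; norm_num
  have hlow : 3.9270 ≤ 3 * ((2 + √5) / (1 + √5)) := by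
    rw [mul_div_assoc', le_div_iff₀ (by linarith)]
    linarith
  refine ⟨hξ.wHatStar_three_le.trans ?_, ⟨hlow, ?_⟩, hξ.wHat_three_le⟩
  · rw [EReal.coe_le_coe_iff]
    linarith
  · rw [mul_div_assoc', div_lt_iff₀ (by linarith)]
    linarith
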